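/- All graphs are finite and simple. The \emph{unit sphere} $S(x)$ of a vertex $x$ is the subgraph induced by the neighbours of $x$. A graph is \emph{contractible} if it is a one-point graph or has a vertex $x$ such that $G-x$ and $S(x)$ are both contractible. A \emph{$(-1)$-sphere} is the empty graph; for $d\ge 0$, a \emph{$d$-sphere} is a graph all of whose unit spheres are $(d-1)$-spheres and which has a vertex $x$ with $G-x$ contractible. A \emph{$2$-ball} is a graph $G$ which is of one of the following two kinds: (a) $G=H-x$ for some $2$-sphere $H$ and some vertex $x$ of $H$; or (b) every unit sphere of $G$ is a path with at least $2$ vertices or a cycle with at least $4$ vertices, $G$ is simply connected (that is, connected, and every closed walk can be reduced to a constant one by inserting and deleting backtracks and replacing two sides of a triangle by the third side and conversely), and the boundary of $G$ is a circle. Here the \emph{boundary vertices} are the vertices whose unit sphere is a path with at least $2$ vertices, the \emph{boundary edges} are the edges between boundary vertices that lie in exactly one triangle, and the boundary is a circle if these vertices and edges form a cycle graph with at least $3$ vertices. The \emph{length of the boundary} of a $2$-ball is the number of its boundary vertices. \textbf{Corollary.} (i) Let $G$ be a $2$-ball whose boundary has length $3k$ for some integer $k$. Then there are no two adjacent boundary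 vertices $a,b$ of $G$ such that $a$ and $b$ have odd degree in $G$ and all other vertices of $G$ have even degree. (ii) (Fisk) Let $G$ be a $2$-sphere. Then there are no two adjacent vertices $a,b$ of $G$ such that $a$ and $b$ have odd degree and all other vertices of $G$ have even degree. -/

import Mathlib

namespace DiscreteSurface

universe u

variable {V : Type u}

/-- Contractibility of the induced subgraph `G[s]`: it is a one-point graph, or it has a vertex `x`
such that both `G[s] - x` and the unit sphere of `x` in `G[s]` are contractible. -/
inductive IsContractible (G : SimpleGraph V) : Set V → Prop
  | point (v : V) : IsContractible G {v}
  | extend (s : Set V) (x : V) (hx : x ∈ s) :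
      IsContractible G (s \ {x}) → IsContractible G (s ∩ G.neighborSet x) → IsContractible G s

/-- `IsSphereAux G n s`: the induced subgraph `G[s]` is an `(n - 1)`-sphere. The `(-1)`-sphere is the
empty graph; a graph is a `d`-sphere (`d ≥ 0`) if all its unit spheres are `(d - 1)`-spheres and the
deletion of some vertex leaves a contractible graph (in particular it is then finite). -/
def IsSphereAux (G : SimpleGraph V) : ℕ → Set V → Prop
  | 0, s => s = ∅
  | n + 1, s => (∀ x ∈ s, IsSphereAux G n (s ∩ G.neighborSet x)) ∧
      ∃ x ∈ s, IsContractible G (s \ {x})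

/-- `G` is a `d`-sphere. -/
def IsSphere (d : ℕ) (G : SimpleGraph V) : Prop := IsSphereAux G (d + 1) Set.univ

/-- `G` is a vertex-deleted `d`-sphere: `G = H - x` for a `d`-sphere `H` and a vertex `x` of `H`. -/
def IsBall (d : ℕ) (G : SimpleGraph V) : Prop :=
  ∃ (W : Type u) (H : SimpleGraph W) (x : W),
    IsSphere d H ∧ Nonempty (G ≃g H.induce ({x}ᶜ : Set W))

/-- The unit sphere of `v`: the subgraph induced by the neighbours of `v`. -/
abbrev unitSphere (G : SimpleGraph V) (v : V) : SimpleGraph (G.neighborSet v) :=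
  G.induce (G.neighborSet v)

/-- The unit sphere of `v` is a cyclic graph with at least four vertices. -/
def IsInteriorVertex (G : SimpleGraph V) (v : V) : Prop :=
  ∃ n, 4 ≤ n ∧ Nonempty (unitSphere G v ≃g SimpleGraph.cycleGraph n)

/-- The unit sphere of `v` is a path graph with at least two vertices. -/
def IsBoundaryVertex (G : SimpleGraph V) (v : V) : Prop :=
  ∃ n, 2 ≤ n ∧ Nonempty (unitSphere G v ≃g SimpleGraph.pathGraph n)

/-- The set of boundary vertices. -/
def boundary (G : SimpleGraph V) : Set V := {v | IsBoundaryVertex G v}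

/-- The boundary curve: its vertices are the boundary vertices, its edges are the edges of `G`
between boundary vertices that lie in exactly one triangle. -/
def boundaryGraph (G : SimpleGraph V) : SimpleGraph (boundary G) where
  Adj a b := G.Adj a b ∧ (G.commonNeighbors (a : V) b).ncard = 1
  symm := ⟨fun _ _ h => ⟨h.1.symm, by rw [SimpleGraph.commonNeighbors_symm]; exact h.2⟩⟩
  loopless := ⟨fun a h => G.loopless.irrefl a h.1⟩

/-- Combinatorial homotopy of walks with fixed end points: the congruence generated by removing
a backtrack `x, y, x` and by replacing two sides of a triangle by the third one. -/
inductive Homotopic (G : SimpleGraph V) : {u v : V} → G.Walk u v → G.Walk u v → Prop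
  | refl {u v : V} (p : G.Walk u v) : Homotopic G p p
  | symm {u v : V} {p q : G.Walk u v} : Homotopic G p q → Homotopic G q p
  | trans {u v : V} {p q r : G.Walk u v} : Homotopic G p q → Homotopic G q r → Homotopic G p r
  | cons {u v w : V} (h : G.Adj u v) {p q : G.Walk v w} :
      Homotopic G p q → Homotopic G (SimpleGraph.Walk.cons h p) (SimpleGraph.Walk.cons h q)
  | backtrack {u v w : V} (h : G.Adj u v) (p : G.Walk u w) :
      Homotopic G (SimpleGraph.Walk.cons h (SimpleGraph.Walk.cons h.symm p)) p
  | triangle {u v w z : V} (h₁ : G.Adj u v) (h₂ : G.Adj v w) (h₃ : G.Adj u w) (p : G.Walk w z) :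
      Homotopic G (SimpleGraph.Walk.cons h₁ (SimpleGraph.Walk.cons h₂ p))
        (SimpleGraph.Walk.cons h₃ p)

/-- `G` is connected and every closed walk is null-homotopic. -/
def IsSimplyConnected (G : SimpleGraph V) : Prop :=
  G.Connected ∧ ∀ (v : V) (p : G.Walk v v), Homotopic G p SimpleGraph.Walk.nil

/-- `G` is a simply connected discrete surface with boundary (all unit spheres are paths or cycles)
whose boundary is a circle. Chords of the boundary and boundary vertices of degree two are allowed,
so that for example single triangles and discs without interior vertices are included. -/
structure IsDisc (G : SimpleGraph V) : Prop where
  unit_spheres : ∀ v, IsInteriorVertex G v ∨ IsBoundaryVertex G v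
  simply_connected : IsSimplyConnected G
  circular_boundary : ∃ n, 3 ≤ n ∧ Nonempty (boundaryGraph G ≃g SimpleGraph.cycleGraph n)

/-- `2`-balls: vertex-deleted `2`-spheres and, including thin ones, all simply connected discrete
surfaces with circular boundary. -/
def IsTwoBall (G : SimpleGraph V) : Prop := IsBall 2 G ∨ IsDisc G

/-- The length of the boundary circle of a `2`-ball, that is, its number of vertices. -/
noncomputable def boundaryLength (G : SimpleGraph V) : ℕ := (boundary G).ncard

end DiscreteSurface

namespace DiscreteSurface

universe u

variable {V : Type u}

/-- Functions with values in `{1, -1}` that are constant along the edges of `G[s]` are constant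
on `s`. -/
def SignConnected (G : SimpleGraph V) (s : Set V) : Prop :=
  ∀ f : V → ℤˣ, (∀ u ∈ s, ∀ v ∈ s, G.Adj u v → f u = f v) → ∀ u ∈ s, ∀ v ∈ s, f u = f v

/-- Every cocycle on `G[s]` with values in `{1, -1}` is a coboundary. -/
def SignAcyclic (G : SimpleGraph V) (s : Set V) : Prop :=
  ∀ c : V → V → ℤˣ, (∀ u ∈ s, ∀ v ∈ s, G.Adj u v → c u v = c v u) →
    (∀ u ∈ s, ∀ v ∈ s, ∀ w ∈ s, G.Adj u v → G.Adj v w → G.Adj u w → c u v * c v w = c u w) →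
    ∃ h : V → ℤˣ, ∀ u ∈ s, ∀ v ∈ s, G.Adj u v → c u v = h u * h v

/-- The common neighbours of two vertices, as a finset. -/
def commonNbrs [Fintype V] (G : SimpleGraph V) [DecidableRel G.Adj] (u v : V) : Finset V :=
  {w | G.Adj u w ∧ G.Adj v w}

/-! ### T-joins: vertex signs as products of edge signs. -/

section Tjoin

variable (G : SimpleGraph V) [DecidableRel G.Adj] (s : Finset V)

/-- A sign function `T` on the vertices of `G[s]` that is the vertex product of a sign function
on the edges. -/
def IsEdgeProduct (T : V → ℤˣ) : Prop :=
  ∃ g : V → V → ℤˣ, (∀ u v, g u v = g v u) ∧ ∀ w ∈ s, ∏ u ∈ s with G.Adj w u, g w u = T w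

variable {G s}

theorem IsEdgeProduct.congr {T T' : V → ℤˣ} (hT : IsEdgeProduct G s T)
    (h : ∀ w ∈ s, T w = T' w) : IsEdgeProduct G s T' := by
  obtain ⟨g, hg, hgT⟩ := hT
  exact ⟨g, hg, fun w hw => (hgT w hw).trans (h w hw)⟩

theorem isEdgeProduct_one : IsEdgeProduct G s fun _ => 1 :=
  ⟨fun _ _ => 1, fun _ _ => rfl, fun _ _ => by simp⟩

theorem IsEdgeProduct.prod {ι : Type*} (t : Finset ι) {T : ι → V → ℤˣ}
    (hT : ∀ i ∈ t, IsEdgeProduct G s (T i)) : IsEdgeProduct G s fun w => ∏ i ∈ t, T i w := by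
  classical
  have hT' : ∀ i, ∃ g : V → V → ℤˣ, (∀ u v, g u v = g v u) ∧
      (i ∈ t → ∀ w ∈ s, ∏ u ∈ s with G.Adj w u, g w u = T i w) := by
    intro i
    by_cases hi : i ∈ t
    · obtain ⟨g, h1, h2⟩ := hT i hi
      exact ⟨g, h1, fun _ => h2⟩
    · exact ⟨fun _ _ => 1, fun _ _ => rfl, fun h => absurd h hi⟩
  choose g hg hgT using hT'
  refine ⟨fun u v => ∏ i ∈ t, g i u v, fun u v => Finset.prod_congr rfl fun i _ => hg i u v,
    fun w hw => ?_⟩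
  rw [Finset.prod_comm]
  exact Finset.prod_congr rfl fun i hi => hgT i hi w hw

theorem IsEdgeProduct.mul {T T' : V → ℤˣ} (hT : IsEdgeProduct G s T)
    (hT' : IsEdgeProduct G s T') : IsEdgeProduct G s fun w => T w * T' w := by
  have := IsEdgeProduct.prod (G := G) (s := s) Finset.univ (T := fun b : Bool => cond b T T')
    (by rintro (_ | _) _ <;> assumption)
  exact this.congr fun w _ => by simp

theorem isEdgeProduct_of_adj [DecidableEq V] {u v : V} (hu : u ∈ s) (hv : v ∈ s) (h : G.Adj u v) (t : ℤˣ) :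
    IsEdgeProduct G s fun z => (if z = u then t else 1) * (if z = v then t else 1) := by
  refine ⟨fun x y => if s(x, y) = s(u, v) then t else 1, fun x y => by simp only [Sym2.eq_swap (a := x)], ?_⟩
  intro w hw
  have huv := h.ne
  by_cases h1 : w = u
  · subst h1
    rw [Finset.prod_eq_single v]
    · simp [huv]
    · intro b _ hb
      simp [hb, huv]
    · intro hn
      simp [hv, h] at hn
  · by_cases h2 : w = v
    · subst h2
      rw [Finset.prod_eq_single u]
      · simp [Sym2.eq_swap, h1]
      · intro b _ hb
        simp [hb, h1]
      · intro hn
        simp [hu, h.symm] at hn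
    · simp [h1, h2]

/-- Multiplying by `t` on an edge `xy` moves the second sign from `x` to `y`. Hence solvability for
the pair spreads along edges, and its indicator is a sign function to which connectedness applies.
-/
theorem SignConnected.isEdgeProduct_pair [DecidableEq V] (hs : SignConnected G (s : Set V)) {u v : V} (hu : u ∈ s)
    (hv : v ∈ s) (t : ℤˣ) :
    IsEdgeProduct G s fun z => (if z = u then t else 1) * (if z = v then t else 1) := by
  classical
  let P : V → Prop := fun v =>
    IsEdgeProduct G s fun z => (if z = u then t else 1) * (if z = v then t else 1)
  have hPu : P u := isEdgeProduct_one.congr fun w _ => by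
    rw [Int.units_mul_self]
  have step : ∀ x ∈ s, ∀ y ∈ s, G.Adj x y → P x → P y := by
    intro x hx y hy hxy hP
    refine (hP.mul (isEdgeProduct_of_adj hx hy hxy t)).congr fun w _ => ?_
    have := Int.units_mul_self (if w = x then t else 1)
    rw [mul_assoc, ← mul_assoc (if w = x then t else 1), this, one_mul]
  have := hs (fun x => if P x then 1 else -1) (by
    intro x hx y hy hxy
    by_cases h : P x
    · simp [h, step x hx y hy hxy h]
    · simp [h, mt (step y hy x hx hxy.symm) h]) u hu v hv
  by_contra hn
  change ¬ P v at hn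
  simp only [hPu, hn, if_true, if_false] at this
  exact absurd this (by decide)

/-- In a connected graph every sign function on the vertices with total product one is the vertex
product of a sign function on the edges. -/
theorem SignConnected.isEdgeProduct (hs : SignConnected G (s : Set V)) {T : V → ℤˣ}
    (hT : ∏ w ∈ s, T w = 1) : IsEdgeProduct G s T := by
  classical
  rcases s.eq_empty_or_nonempty with rfl | ⟨u, hu⟩
  · exact ⟨fun _ _ => 1, fun _ _ => rfl, by simp⟩
  -- Joining every `w` to the base vertex `u` with sign `T w` gives `T` everywhere, up to a factor
  -- at `u` that is the total product, hence one.
  refine (IsEdgeProduct.prod s fun w hw => hs.isEdgeProduct_pair hu hw (T w)).congr ?_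
  intro z hz
  rw [Finset.prod_mul_distrib]
  have : ∏ i ∈ s, (if z = i then T i else 1) = T z := by simp [hz]
  rw [this]
  by_cases h : z = u
  · simp [h, hT]
  · simp [h]

end Tjoin

/-! ### From local to global signings of triangles. -/

section Colouring

variable [Fintype V] {G : SimpleGraph V} [DecidableRel G.Adj]

theorem mem_commonNbrs {u v w : V} : w ∈ commonNbrs G u v ↔ G.Adj u w ∧ G.Adj v w := by
  simp [commonNbrs]

theorem commonNbrs_comm (u v : V) : commonNbrs G u v = commonNbrs G v u := by
  ext x
  simp [mem_commonNbrs, and_comm]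

theorem card_commonNbrs (u v : V) : (G.commonNeighbors u v).ncard = (commonNbrs G u v).card := by
  rw [← Set.ncard_coe_finset]
  congr 1
  ext w
  simp [mem_commonNbrs, SimpleGraph.mem_commonNeighbors]

/-- A sign colouring of the triangles such that the two triangles at an edge `uv` have
colours of product `F u v`. -/
theorem exists_triangle_colouring (hconn : ∀ v, SignConnected G (G.neighborSet v))
    (hcard : ∀ u v, G.Adj u v → (commonNbrs G u v).card = 1 ∨ (commonNbrs G u v).card = 2)
    (hac : SignAcyclic G Set.univ) (F : V → V → ℤˣ) (hF : ∀ u v, F u v = F v u)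
    (hprod : ∀ v, ∏ w ∈ G.neighborFinset v, F v w = 1) :
    ∃ (σ : V → V → V → ℤˣ) (h : V → ℤˣ),
      (∀ u v w, G.Adj u v → G.Adj u w → G.Adj v w → σ u v w = σ v u w ∧ σ u v w = σ u w v) ∧
      (∀ u v w w', G.Adj u v → w ∈ commonNbrs G u v → w' ∈ commonNbrs G u v → w ≠ w' →
        σ u v w * σ u v w' = F u v) ∧
      (∀ u v w, G.Adj u v → w ∈ commonNbrs G u v → (commonNbrs G u v).card = 1 →
        σ u v w = F u v * h u) := by
  classical
  -- An edge `uw` of the unit sphere of `v` is a triangle `vuw`, so `g v` signs the triangles at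
  -- `v`.
  have key : ∀ v, IsEdgeProduct G (G.neighborFinset v) (F v) := fun v =>
    SignConnected.isEdgeProduct (by rw [SimpleGraph.coe_neighborFinset]; exact hconn v) (hprod v)
  choose g hgs hg using key
  have hg' : ∀ v w, G.Adj v w → ∏ x ∈ commonNbrs G v w, g v w x = F v w := by
    intro v w hvw
    rw [← hg v w (by simpa using hvw)]
    apply Finset.prod_congr _ fun _ _ => rfl
    ext x
    simp [mem_commonNbrs]
  have hcomm : ∀ u v, commonNbrs G u v = commonNbrs G v u := commonNbrs_comm
  have one : ∀ u v w, G.Adj u v → w ∈ commonNbrs G u v → (commonNbrs G u v).card = 1 →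
      g u v w = F u v := by
    intro u v w huv hw h1
    rw [← hg' u v huv]
    obtain ⟨x, hx⟩ := Finset.card_eq_one.mp h1
    rw [hx, Finset.mem_singleton] at hw
    rw [hx, Finset.prod_singleton, hw]
  have two : ∀ u v w w', G.Adj u v → w ∈ commonNbrs G u v → w' ∈ commonNbrs G u v → w ≠ w' →
      g u v w * g u v w' = F u v := by
    intro u v w w' huv hw hw' hne
    rw [← hg' u v huv]
    have : commonNbrs G u v = {w, w'} := by
      symm
      apply Finset.eq_of_subset_of_card_le
      · intro x hx
        simp only [Finset.mem_insert, Finset.mem_singleton] at hx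
        rcases hx with rfl | rfl <;> assumption
      · rw [Finset.card_pair hne]
        have := hcard u v huv
        omega
    rw [this, Finset.prod_pair hne]
  have ex : ∀ u v, ∃ w, G.Adj u v → w ∈ commonNbrs G u v := by
    intro u v
    by_cases huv : G.Adj u v
    · have : (commonNbrs G u v).Nonempty := by
        rw [← Finset.card_pos]
        have := hcard u v huv
        omega
      exact ⟨this.choose, fun _ => this.choose_spec⟩
    · exact ⟨u, fun h => absurd h huv⟩
  choose t ht using ex
  have mv : ∀ a b c d : ℤˣ, a * b = c * d → a * c = b * d := by decide
  -- Both `g u` and `g v` have product `F u v` over the two triangles at `uv`, so their ratio does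
  -- not depend on the triangle; the choice `t u v` is harmless.
  have indep : ∀ u v w w', G.Adj u v → w ∈ commonNbrs G u v → w' ∈ commonNbrs G u v →
      g u v w * g v u w = g u v w' * g v u w' := by
    intro u v w w' huv hw hw'
    by_cases hne : w = w'
    · rw [hne]
    · apply mv
      rw [two u v w w' huv hw hw' hne,
        two v u w w' huv.symm (hcomm u v ▸ hw) (hcomm u v ▸ hw') hne, hF]
  have hc : ∀ u v w, G.Adj u v → w ∈ commonNbrs G u v →
      g u v (t u v) * g v u (t u v) = g u v w * g v u w := fun u v w huv hw =>
    indep u v _ _ huv (ht u v huv) hw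
  -- Cocycle condition: evaluated on the one triangle `uvw`, the two factors of `g v` cancel.
  obtain ⟨h, hh⟩ := hac (fun u v => g u v (t u v) * g v u (t u v))
    (by
      intro u _ v _ huv
      rw [hc v u (t u v) huv.symm (hcomm u v ▸ ht u v huv), mul_comm])
    (by
      intro u _ v _ w _ huv hvw huw
      rw [hc u v w huv (mem_commonNbrs.2 ⟨huw, hvw⟩),
        hc v w u hvw (mem_commonNbrs.2 ⟨huv.symm, huw.symm⟩),
        hc u w v huw (mem_commonNbrs.2 ⟨huv, hvw.symm⟩), hgs v w u, hgs u w v, hgs w v u,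
        mul_assoc, ← mul_assoc (g v u w), Int.units_mul_self, one_mul])
  -- The factor `h u` cancels over two triangles, but survives at an edge lying in only one.
  refine ⟨fun u v w => g u v w * h u, h, ?_, ?_, ?_⟩
  · intro u v w huv huw hvw
    refine ⟨?_, congrArg (· * h u) (hgs u v w)⟩
    have h1 := hh u trivial v trivial huv
    rw [hc u v w huv (mem_commonNbrs.2 ⟨huw, hvw⟩)] at h1
    exact mv _ _ _ _ h1
  · intro u v w w' huv hw hw' hne
    have h1 := two u v w w' huv hw hw' hne
    rw [mul_mul_mul_comm, Int.units_mul_self, mul_one, h1]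
  · intro u v w huv hw h1
    exact congrArg (· * h u) (one u v w huv hw h1)

end Colouring

/-! ### Counting triangle signs mod 3. -/

section Counting

variable [Fintype V] {G : SimpleGraph V} [DecidableRel G.Adj]

/-- The sum of a symmetric function over all ordered triangles is divisible by three. -/
theorem sum_ordered_triangles_eq_zero (f : V → V → V → ZMod 3)
    (hf : ∀ u v w, G.Adj u v → G.Adj u w → G.Adj v w → f u v w = f v u w ∧ f u v w = f u w v) :
    ∑ u, ∑ v, (if G.Adj u v then ∑ w ∈ commonNbrs G u v, f u v w else 0) = 0 := by
  let k : V → V → V → ZMod 3 := fun u v w =>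
    if G.Adj u v ∧ G.Adj u w ∧ G.Adj v w then f u v w else 0
  have k1 : ∀ u v w, k u v w = k v u w := by
    intro u v w
    simp only [k, G.adj_comm v u]
    by_cases h : G.Adj u v ∧ G.Adj u w ∧ G.Adj v w
    · rw [if_pos h, if_pos ⟨h.1, h.2.2, h.2.1⟩, (hf u v w h.1 h.2.1 h.2.2).1]
    · rw [if_neg h, if_neg (by tauto)]
  have k2 : ∀ u v w, k u v w = k u w v := by
    intro u v w
    simp only [k, G.adj_comm w v]
    by_cases h : G.Adj u v ∧ G.Adj u w ∧ G.Adj v w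
    · rw [if_pos h, if_pos ⟨h.2.1, h.1, h.2.2⟩, (hf u v w h.1 h.2.1 h.2.2).2]
    · rw [if_neg h, if_neg (by tauto)]
  let e := Fintype.equivFin V
  -- Rotating the least vertex of a triangle to the front splits the sum into three equal parts.
  let m : V → V → V → ZMod 3 := fun u v w => if e u < e v ∧ e u < e w then k u v w else 0
  have split : ∀ u v w, k u v w = m u v w + m v u w + m w u v := by
    intro u v w
    simp only [m]
    rw [← k1 u v w, ← (k2 u w v).trans (k1 u v w) |>.trans (k1 v u w), k1 w u v, k2 u w v]
    by_cases h : G.Adj u v ∧ G.Adj u w ∧ G.Adj v w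
    · have a1 : e u ≠ e v := fun hh => h.1.ne (e.injective hh)
      have a2 : e u ≠ e w := fun hh => h.2.1.ne (e.injective hh)
      have a3 : e v ≠ e w := fun hh => h.2.2.ne (e.injective hh)
      split_ifs <;> first | (exfalso; omega) | simp
    · have : k u v w = 0 := if_neg h
      simp [this]
  have eq : ∀ u v, (if G.Adj u v then ∑ w ∈ commonNbrs G u v, f u v w else 0) = ∑ w, k u v w := by
    intro u v
    split_ifs with h
    · rw [commonNbrs, Finset.sum_filter]
      simp [k, h]
    · simp [k, h]
  simp_rw [eq, split, Finset.sum_add_distrib]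
  have s1 : ∑ u, ∑ v, ∑ w, m v u w = ∑ u, ∑ v, ∑ w, m u v w := Finset.sum_comm
  have s2 : ∑ u, ∑ v, ∑ w, m w u v = ∑ u, ∑ v, ∑ w, m u v w := by
    calc ∑ u, ∑ v, ∑ w, m w u v = ∑ u, ∑ w, ∑ v, m w u v :=
          Finset.sum_congr rfl fun u _ => Finset.sum_comm
      _ = _ := Finset.sum_comm
  rw [s1, s2]
  generalize ∑ u, ∑ v, ∑ w, m u v w = x
  revert x
  decide

/-- The counting argument: for a sign colouring of the triangles, the sums over the triangles at an
edge cannot be prescribed by a weight of total zero for all edges but one. -/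
theorem false_of_edge_weights [DecidableEq V] (σ : V → V → V → ℤˣ)
    (hσ : ∀ u v w, G.Adj u v → G.Adj u w → G.Adj v w → σ u v w = σ v u w ∧ σ u v w = σ u w v)
    (m : V → V → ZMod 3) (hm : ∀ u v, m u v = m v u)
    (hm0 : ∑ u, ∑ v, (if G.Adj u v then m u v else 0) = 0)
    {a b : V} (hab : G.Adj a b)
    (h1 : ∀ u v, G.Adj u v → s(u, v) ≠ s(a, b) →
      ∑ w ∈ commonNbrs G u v, ((σ u v w : ℤ) : ZMod 3) = m u v)
    (h2 : ∑ w ∈ commonNbrs G a b, ((σ a b w : ℤ) : ZMod 3) ≠ m a b) : False := by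
  have hS := sum_ordered_triangles_eq_zero (G := G) (fun u v w => ((σ u v w : ℤ) : ZMod 3))
    (fun u v w h h' h'' => by
      rw [← (hσ u v w h h' h'').1, ← (hσ u v w h h' h'').2]; exact ⟨rfl, rfl⟩)
  set E : V → V → ZMod 3 := fun u v => ∑ w ∈ commonNbrs G u v, ((σ u v w : ℤ) : ZMod 3)
  have hE : ∀ u v, G.Adj u v → E u v = E v u := by
    intro u v huv
    simp only [E, commonNbrs_comm u v]
    refine Finset.sum_congr rfl fun w hw => ?_
    rw [mem_commonNbrs] at hw
    rw [(hσ u v w huv hw.2 hw.1).1]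
  -- The discrepancy at `ab` enters once for each orientation, and twice a nonzero element is
  -- nonzero mod 3.
  have hdiff : ∀ u v, (if G.Adj u v then E u v else 0) = (if G.Adj u v then m u v else 0) +
      ((if u = a then (if v = b then E a b - m a b else 0) else 0) +
       (if u = b then (if v = a then E a b - m a b else 0) else 0)) := by
    intro u v
    by_cases huv : G.Adj u v
    · by_cases hs : s(u, v) = s(a, b)
      · rcases Sym2.eq_iff.1 hs with ⟨rfl, rfl⟩ | ⟨rfl, rfl⟩
        · simp [huv, huv.ne]
        · simp [huv, huv.ne, hE u v huv, hm u v]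
      · have h3 : ¬ (u = a ∧ v = b) := fun h => hs (by rw [h.1, h.2])
        have h4 : ¬ (u = b ∧ v = a) := fun h => hs (by rw [h.1, h.2, Sym2.eq_swap])
        have : E u v = m u v := h1 u v huv hs
        simp only [huv, if_true, this, ← ite_and, h3, h4, if_false, add_zero]
    · have h3 : ¬ (u = a ∧ v = b) := fun h => huv (by rwa [h.1, h.2])
      have h4 : ¬ (u = b ∧ v = a) := fun h => huv (by rw [h.1, h.2]; exact hab.symm)
      simp only [huv, if_false, ← ite_and, h3, h4, add_zero]
  have : ∑ u, ∑ v, (if G.Adj u v then E u v else 0) = 0 := hS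
  simp_rw [hdiff, Finset.sum_add_distrib] at this
  rw [hm0] at this
  simp at this
  have h0 : E a b - m a b ≠ 0 := sub_ne_zero.2 h2
  revert this h0
  generalize E a b - m a b = x
  revert x
  decide

end Counting

/-! ### The contradiction for surfaces and for punctured spheres. -/

section Parity

variable [Fintype V] [DecidableEq V] {G : SimpleGraph V} [DecidableRel G.Adj]

theorem prod_edge_sign {a b : V} (hab : G.Adj a b) (z : V) :
    ∏ w ∈ G.neighborFinset z, (if s(z, w) = s(a, b) then (-1 : ℤˣ) else 1) =
      if z = a ∨ z = b then -1 else 1 := by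
  by_cases h1 : z = a
  · subst h1
    rw [Finset.prod_eq_single b]
    · simp
    · intro w _ hw
      simp [hw, hab.ne]
    · intro hn
      simp [hab] at hn
  · by_cases h2 : z = b
    · subst h2
      rw [Finset.prod_eq_single a]
      · simp [Sym2.eq_swap]
      · intro w _ hw
        simp [hw, h1]
      · intro hn
        simp [hab.symm] at hn
    · simp [h1, h2]

theorem sign_add_eq_zero {s t : ℤˣ} (h : s * t = -1) :
    ((s : ℤ) : ZMod 3) + ((t : ℤ) : ZMod 3) = 0 := by
  revert s t
  decide

theorem sign_add_eq_two_mul {s t : ℤˣ} (h : s * t = 1) :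
    ((s : ℤ) : ZMod 3) + ((t : ℤ) : ZMod 3) = 2 * ((s : ℤ) : ZMod 3) := by
  revert s t
  decide

theorem sign_ne_zero (s : ℤˣ) : 2 * ((s : ℤ) : ZMod 3) ≠ 0 := by
  revert s
  decide

theorem sign_ne_neg (s : ℤˣ) : ((s : ℤ) : ZMod 3) ≠ -((s : ℤ) : ZMod 3) := by
  revert s
  decide

theorem prod_sign_eq_one {n : ℕ} {p : Prop} [Decidable p] (h : Odd n ↔ p) :
    (-1 : ℤˣ) ^ n * (if p then -1 else 1) = 1 := by
  by_cases hp : p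
  · simp [hp, (h.2 hp).neg_one_pow]
  · have : Even n := Nat.not_odd_iff_even.1 fun hn => hp (h.1 hn)
    simp [hp, this.neg_one_pow]

/-- A simply connected surface with connected boundary, of length divisible by three, has no two
adjacent vertices which are exactly the vertices of odd degree. -/
theorem surface_no_odd_pair (hconn : ∀ v, SignConnected G (G.neighborSet v))
    (hcard : ∀ u v, G.Adj u v → (commonNbrs G u v).card = 1 ∨ (commonNbrs G u v).card = 2)
    (hac : SignAcyclic G Set.univ)
    (hbconn : ∀ h : V → ℤˣ, (∀ u v, G.Adj u v → (commonNbrs G u v).card = 1 → h u = h v) →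
      ∃ κ, ∀ u v, G.Adj u v → (commonNbrs G u v).card = 1 → h u = κ)
    (hblen : ∑ u, ∑ v, (if G.Adj u v ∧ (commonNbrs G u v).card = 1 then (1 : ZMod 3) else 0) = 0)
    {a b : V} (hab : G.Adj a b) (hodd : ∀ v, Odd (G.degree v) ↔ v = a ∨ v = b) : False := by
  obtain ⟨σ, h, hσ, hσ2, hσ1⟩ := exists_triangle_colouring hconn hcard hac
    (fun u v => -1 * if s(u, v) = s(a, b) then -1 else 1)
    (fun u v => by simp only [Sym2.eq_swap (a := u)])
    (fun z => by
      rw [Finset.prod_mul_distrib, prod_edge_sign hab, Finset.prod_const,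
        SimpleGraph.card_neighborFinset_eq_degree]
      exact prod_sign_eq_one (hodd z))
  -- The only triangle at a boundary edge `uv` has sign `F u v * h u` and also `F u v * h v`.
  obtain ⟨κ, hκ⟩ := hbconn h (by
    intro u v huv h1
    obtain ⟨w, hw⟩ := Finset.card_eq_one.mp h1
    have hw' : w ∈ commonNbrs G u v := by simp [hw]
    have hw2 := mem_commonNbrs.1 hw'
    have e1 := hσ1 u v w huv hw' h1
    have e2 := hσ1 v u w huv.symm (commonNbrs_comm (G := G) u v ▸ hw') (commonNbrs_comm (G := G) u v ▸ h1)
    rw [← (hσ u v w huv hw2.1 hw2.2).1, e1, Sym2.eq_swap (a := v)] at e2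
    exact mul_left_cancel e2)
  have hpair : ∀ u v, G.Adj u v → (commonNbrs G u v).card ≠ 1 →
      ∃ w w', w ∈ commonNbrs G u v ∧ w' ∈ commonNbrs G u v ∧ w ≠ w' ∧
        commonNbrs G u v = {w, w'} := by
    intro u v huv h1
    obtain ⟨w, w', hne, he⟩ := Finset.card_eq_two.1 ((hcard u v huv).resolve_left h1)
    exact ⟨w, w', by simp [he], by simp [he], hne, he⟩
  refine false_of_edge_weights σ hσ
    (fun u v => if (commonNbrs G u v).card = 1 then -((κ : ℤ) : ZMod 3) else 0)
    (fun u v => by rw [commonNbrs_comm]) ?_ hab ?_ ?_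
  · simp_rw [← ite_and]
    calc _ = -((κ : ℤ) : ZMod 3) * ∑ u, ∑ v,
          (if G.Adj u v ∧ (commonNbrs G u v).card = 1 then (1 : ZMod 3) else 0) := by
          simp_rw [Finset.mul_sum]
          simp
      _ = 0 := by rw [hblen, mul_zero]
  · intro u v huv hs
    by_cases h1 : (commonNbrs G u v).card = 1
    · obtain ⟨w, hw⟩ := Finset.card_eq_one.mp h1
      have := hσ1 u v w huv (by simp [hw]) h1
      rw [if_neg hs, mul_one] at this
      rw [if_pos h1, hw, Finset.sum_singleton, this, hκ u v huv h1]
      simp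
    · obtain ⟨w, w', hw, hw', hne, he⟩ := hpair u v huv h1
      have := hσ2 u v w w' huv hw hw' hne
      rw [if_neg hs, mul_one] at this
      rw [if_neg h1, he, Finset.sum_pair hne, sign_add_eq_zero this]
  -- If `ab` is a boundary edge, its triangle has sign `κ` instead of `-κ`; otherwise two equal
  -- signs add up to a nonzero value.
  · by_cases h1 : (commonNbrs G a b).card = 1
    · obtain ⟨w, hw⟩ := Finset.card_eq_one.mp h1
      have := hσ1 a b w hab (by simp [hw]) h1
      rw [if_pos rfl, hκ a b hab h1] at this
      rw [if_pos h1, hw, Finset.sum_singleton, this]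
      simpa using sign_ne_neg κ
    · obtain ⟨w, w', hw, hw', hne, he⟩ := hpair a b hab h1
      have := hσ2 a b w w' hab hw hw' hne
      rw [if_pos rfl] at this
      rw [if_neg h1, he, Finset.sum_pair hne, sign_add_eq_two_mul (by simpa using this)]
      exact sign_ne_zero _

/-- The version of `surface_no_odd_pair` for a sphere `G` with a vertex `x` removed. -/
theorem punctured_no_odd_pair (hconn : ∀ v, SignConnected G (G.neighborSet v))
    (hcard : ∀ u v, G.Adj u v → (commonNbrs G u v).card = 2)
    (hac : SignAcyclic G Set.univ) {x : V} (hx : 3 ∣ G.degree x)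
    {a b : V} (hab : G.Adj a b) (hax : a ≠ x) (hbx : b ≠ x)
    (hodd : ∀ v, v ≠ x → (Odd (G.degree v + if G.Adj x v then 1 else 0) ↔ v = a ∨ v = b)) :
    False := by
  -- This factor turns the prescription at edges of `x` into `+1`. It also corrects the parity at
  -- neighbours of `x`, which lose an edge when `x` is deleted.
  let X : V → V → ℤˣ := fun u v => if u = x ∨ v = x then -1 else 1
  have hX : ∀ u v, X u v = X v u := fun u v => by simp only [X, or_comm]
  obtain ⟨σ, h, hσ, hσ2, -⟩ := exists_triangle_colouring hconn
    (fun u v huv => Or.inr (hcard u v huv)) hac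
    (fun u v => -1 * (if s(u, v) = s(a, b) then -1 else 1) * X u v)
    (fun u v => by simp only [Sym2.eq_swap (a := u), hX u v])
    (fun z => by
      rw [Finset.prod_mul_distrib, Finset.prod_mul_distrib, prod_edge_sign hab, Finset.prod_const,
        SimpleGraph.card_neighborFinset_eq_degree]
      by_cases hz : z = x
      · subst hz
        simp [X, hax.symm, hbx.symm, ← mul_pow]
      · have : ∏ w ∈ G.neighborFinset z, X z w = (-1) ^ (if G.Adj x z then 1 else 0) := by
          simp [X, hz, G.adj_comm x z]
        rw [this, mul_right_comm, ← pow_add]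
        exact prod_sign_eq_one (hodd z hz))
  have hpair : ∀ u v, G.Adj u v →
      ∃ w w', w ∈ commonNbrs G u v ∧ w' ∈ commonNbrs G u v ∧ w ≠ w' ∧
        commonNbrs G u v = {w, w'} := by
    intro u v huv
    obtain ⟨w, w', hne, he⟩ := Finset.card_eq_two.1 (hcard u v huv)
    exact ⟨w, w', by simp [he], by simp [he], hne, he⟩
  have hsx : ∀ u v, u = x ∨ v = x → s(u, v) ≠ s(a, b) := by
    rintro u v h' he
    rcases Sym2.eq_iff.1 he with ⟨rfl, rfl⟩ | ⟨rfl, rfl⟩ <;> tauto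
  obtain ⟨κ, hκ⟩ : ∃ κ, ∀ u w, G.Adj x u → w ∈ commonNbrs G x u → σ x u w = κ := by
    have ex : ∀ u, ∃ w, G.Adj x u → w ∈ commonNbrs G x u := by
      intro u
      by_cases hu : G.Adj x u
      · obtain ⟨w, -, hw, -⟩ := hpair x u hu
        exact ⟨w, fun _ => hw⟩
      · exact ⟨u, fun h => absurd h hu⟩
    choose t ht using ex
    have ind : ∀ u w, G.Adj x u → w ∈ commonNbrs G x u → σ x u w = σ x u (t u) := by
      intro u w hu hw
      by_cases hne : w = t u
      · rw [← hne]
      · have := hσ2 x u w (t u) hu hw (ht u hu) hne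
        simp only [hsx x u (Or.inl rfl), if_false, mul_one, X, true_or, if_true] at this
        revert this
        generalize σ x u w = p
        generalize σ x u (t u) = q
        revert p q
        decide
    -- Consecutive triangles around `x` agree, and the unit sphere of `x` is connected.
    have con := hconn x (fun u => σ x u (t u)) (by
      intro u hu w hw huw
      rw [SimpleGraph.mem_neighborSet] at hu hw
      rw [← ind u w hu (mem_commonNbrs.2 ⟨hw, huw⟩),
        ← ind w u hw (mem_commonNbrs.2 ⟨hu, huw.symm⟩), (hσ x u w hu hw huw).2])
    by_cases hne : ∃ u, G.Adj x u
    · obtain ⟨u, hu⟩ := hne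
      exact ⟨σ x u (t u), fun w z hw hz => (ind w z hw hz).trans (con w hw u hu)⟩
    · exact ⟨1, fun u w hu => absurd ⟨u, hu⟩ hne⟩
  refine false_of_edge_weights σ hσ
    (fun u v => if u = x ∨ v = x then 2 * ((κ : ℤ) : ZMod 3) else 0)
    (fun u v => by simp only [or_comm]) ?_ hab ?_ ?_
  · obtain ⟨k, hk⟩ := hx
    have h3 : (3 : ZMod 3) = 0 := by decide
    have hdeg : ∀ c : ZMod 3, ∑ v, (if G.Adj x v then c else 0) = 0 := by
      intro c
      rw [← Finset.sum_filter, Finset.sum_const, nsmul_eq_mul]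
      have : (Finset.univ.filter fun v => G.Adj x v).card = G.degree x := by
        rw [← SimpleGraph.card_neighborFinset_eq_degree]
        congr 1
        ext
        simp
      rw [this, hk]
      push_cast
      rw [h3, zero_mul, zero_mul]
    have hsplit : ∀ u v, (if G.Adj u v then
        (if u = x ∨ v = x then 2 * ((κ : ℤ) : ZMod 3) else 0) else 0) =
        (if u = x then (if G.Adj x v then 2 * ((κ : ℤ) : ZMod 3) else 0) else 0) +
        (if v = x then (if G.Adj x u then 2 * ((κ : ℤ) : ZMod 3) else 0) else 0) := by
      intro u v
      by_cases hu : u = x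
      · subst hu
        by_cases hv : v = u
        · subst hv
          simp
        · simp [hv]
      · by_cases hv : v = x
        · subst hv
          simp [hu, G.adj_comm]
        · simp [hu, hv]
    simp_rw [hsplit, Finset.sum_add_distrib]
    simp [hdeg]
  · intro u v huv hs
    obtain ⟨w, w', hw, hw', hne, he⟩ := hpair u v huv
    have e1 := hσ2 u v w w' huv hw hw' hne
    rw [if_neg hs, mul_one] at e1
    rw [he, Finset.sum_pair hne]
    by_cases hxx : u = x ∨ v = x
    · have e2 : σ u v w = κ := by
        rcases hxx with rfl | rfl
        · exact hκ v w huv hw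
        · have := mem_commonNbrs.1 hw
          rw [(hσ u v w huv this.1 this.2).1]
          exact hκ u w huv.symm (commonNbrs_comm (G := G) u v ▸ hw)
      rw [if_pos hxx, sign_add_eq_two_mul (by simpa [X, hxx] using e1), e2]
    · rw [if_neg hxx, sign_add_eq_zero (by simpa [X, hxx] using e1)]
  · obtain ⟨w, w', hw, hw', hne, he⟩ := hpair a b hab
    have := hσ2 a b w w' hab hw hw' hne
    rw [he, Finset.sum_pair hne, sign_add_eq_two_mul (by simpa [X, hax, hbx] using this)]
    simpa [hax, hbx] using sign_ne_zero (σ a b w)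

end Parity

/-! ### Connectedness and acyclicity of contractible graphs. -/

section Contractible

variable {G : SimpleGraph V} {s : Set V} {x : V}

theorem SignConnected.of_sdiff_singleton (h : SignConnected G (s \ {x}))
    (hne : (s ∩ G.neighborSet x).Nonempty) : SignConnected G s := by
  intro f hf
  have hc := h f fun u hu v hv => hf u hu.1 v hv.1
  obtain ⟨y, hys, hxy⟩ := hne
  rw [SimpleGraph.mem_neighborSet] at hxy
  have key : ∀ u ∈ s, f u = f y := by
    intro u hu
    by_cases hux : u = x
    · subst hux
      exact hf u hu y hys hxy
    · exact hc u ⟨hu, hux⟩ y ⟨hys, hxy.ne'⟩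
  intro u hu v hv
  rw [key u hu, key v hv]

/-- A potential `h` off `x` extends to `x` when `c x u * h u` is the same for all neighbours `u`.
The cocycle condition makes it constant along edges of the unit sphere, which is connected. -/
theorem SignAcyclic.of_sdiff_singleton (hx : x ∈ s) (h : SignAcyclic G (s \ {x}))
    (hl : SignConnected G (s ∩ G.neighborSet x)) : SignAcyclic G s := by
  classical
  intro c hsymm hc
  obtain ⟨h, hh⟩ := h c (fun u hu v hv => hsymm u hu.1 v hv.1)
    fun u hu v hv w hw => hc u hu.1 v hv.1 w hw.1
  have hconst := hl (fun u => c x u * h u) (by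
    intro u hu v hv huv
    have hxu : G.Adj x u := hu.2
    have hxv : G.Adj x v := hv.2
    have e1 := hc x hx u hu.1 v hv.1 hxu huv hxv
    have e2 := hh u ⟨hu.1, hxu.ne'⟩ v ⟨hv.1, hxv.ne'⟩ huv
    rw [← e1, e2, mul_assoc, mul_assoc, Int.units_mul_self, mul_one])
  obtain ⟨κ, hκ⟩ : ∃ κ, ∀ u ∈ s, G.Adj x u → c x u = κ * h u := by
    by_cases hne : (s ∩ G.neighborSet x).Nonempty
    · obtain ⟨y, hy⟩ := hne
      refine ⟨c x y * h y, fun u hu hxu => ?_⟩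
      rw [← hconst u ⟨hu, hxu⟩ y hy, mul_assoc, Int.units_mul_self, mul_one]
    · exact ⟨1, fun u hu hxu => absurd ⟨u, hu, hxu⟩ hne⟩
  refine ⟨Function.update h x κ, fun u hu v hv huv => ?_⟩
  by_cases hux : u = x
  · subst hux
    rw [Function.update_self, Function.update_of_ne huv.ne', hκ v hv huv]
  · by_cases hvx : v = x
    · subst hvx
      rw [Function.update_self, Function.update_of_ne hux, hsymm u hu v hv huv,
        hκ u hu huv.symm, mul_comm]
    · rw [Function.update_of_ne hux, Function.update_of_ne hvx, hh u ⟨hu, hux⟩ v ⟨hv, hvx⟩ huv]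

theorem IsContractible.nonempty (h : IsContractible G s) : s.Nonempty := by
  cases h with
  | point v => exact Set.singleton_nonempty v
  | extend _ x hx => exact ⟨x, hx⟩

theorem IsContractible.finite (h : IsContractible G s) : s.Finite := by
  induction h with
  | point v => exact Set.finite_singleton v
  | extend s x _ _ _ ih _ =>
    exact (ih.insert x).subset fun y hy => by
      by_cases hyx : y = x
      · exact Or.inl hyx
      · exact Or.inr ⟨hy, hyx⟩

theorem IsContractible.signConnected (h : IsContractible G s) : SignConnected G s := by
  induction h with
  | point v =>
    rintro f - u rfl v rfl
    rfl
  | extend s x _ _ h2 ih _ => exact ih.of_sdiff_singleton h2.nonempty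

theorem IsContractible.signAcyclic (h : IsContractible G s) : SignAcyclic G s := by
  induction h with
  | point v =>
    refine fun c _ _ => ⟨fun _ => 1, ?_⟩
    rintro u rfl v rfl huv
    exact absurd rfl huv.ne
  | extend s x hx _ h2 ih _ => exact ih.of_sdiff_singleton hx h2.signConnected

end Contractible

/-! ### Spheres. -/

section Sphere

variable {G : SimpleGraph V} {s : Set V}

/-- Empty unit spheres mean no edges, whereas a contractible graph other than a point has an edge.
So deleting `x` leaves a point. -/
theorem IsSphereAux.ncard_eq_two (h : IsSphereAux G 1 s) : s.ncard = 2 := by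
  obtain ⟨h0, x, hx, hc⟩ := h
  have hsub : ∃ y, s \ {x} = {y} := by
    generalize ht : s \ {x} = t at hc
    cases hc with
    | point v => exact ⟨v, rfl⟩
    | extend _ z hz _ h2 =>
      obtain ⟨w, hw, hzw⟩ := h2.nonempty
      rw [← ht] at hz hw
      have : s ∩ G.neighborSet z = ∅ := h0 z hz.1
      exact absurd (show w ∈ s ∩ G.neighborSet z from ⟨hw.1, hzw⟩) (by simp [this])
  obtain ⟨y, hy⟩ := hsub
  have hys : y ∈ s \ {x} := by simp [hy]
  have : s = {x, y} := by
    rw [← Set.insert_sdiff_self_of_mem hx, hy]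
  rw [this, Set.ncard_pair (Ne.symm hys.2)]

theorem IsSphereAux.nonempty {n : ℕ} (h : IsSphereAux G (n + 1) s) : s.Nonempty := by
  obtain ⟨-, x, hx, -⟩ := h
  exact ⟨x, hx⟩

theorem IsSphereAux.signConnected {n : ℕ} (h : IsSphereAux G (n + 2) s) : SignConnected G s := by
  obtain ⟨h0, x, hx, hc⟩ := h
  exact hc.signConnected.of_sdiff_singleton (h0 x hx).nonempty

theorem IsSphereAux.signAcyclic {n : ℕ} (h : IsSphereAux G (n + 3) s) : SignAcyclic G s := by
  obtain ⟨h0, x, hx, hc⟩ := h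
  exact hc.signAcyclic.of_sdiff_singleton hx (h0 x hx).signConnected

theorem IsSphereAux.finite {n : ℕ} (h : IsSphereAux G (n + 1) s) : s.Finite := by
  obtain ⟨-, x, hx, hc⟩ := h
  rw [← Set.insert_sdiff_self_of_mem hx]
  exact hc.finite.insert x

theorem IsSphere.signConnected_neighborSet (h : IsSphere 2 G) (v : V) :
    SignConnected G (G.neighborSet v) := by
  have := (h.1 v trivial).signConnected
  rwa [Set.univ_inter] at this

theorem IsSphere.ncard_commonNeighbors (h : IsSphere 2 G) {u v : V} (huv : G.Adj u v) :
    (G.commonNeighbors u v).ncard = 2 := by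
  have := ((h.1 u trivial).1 v ⟨trivial, huv⟩).ncard_eq_two
  rwa [Set.univ_inter] at this

end Sphere

/-! ### Discs: homotopy of walks, and triangles at an edge. -/

section Disc

variable {G : SimpleGraph V}

/-- The product of a sign function on the edges along a walk. -/
def walkSign (c : V → V → ℤˣ) : {u v : V} → G.Walk u v → ℤˣ
  | _, _, .nil => 1
  | _, _, .cons (u := u) (v := v) _ p => c u v * walkSign c p

theorem walkSign_append (c : V → V → ℤˣ) {u v w : V} (p : G.Walk u v) (q : G.Walk v w) :
    walkSign c (p.append q) = walkSign c p * walkSign c q := by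
  induction p with
  | nil => simp [walkSign]
  | cons h p ih => simp [walkSign, ih, mul_assoc]

theorem walkSign_reverse {c : V → V → ℤˣ} (hc : ∀ u v, G.Adj u v → c u v = c v u) {u v : V}
    (p : G.Walk u v) : walkSign c p.reverse = walkSign c p := by
  induction p with
  | nil => simp [walkSign]
  | cons h p ih =>
    rw [SimpleGraph.Walk.reverse_cons, walkSign_append, ih]
    simp [walkSign, hc _ _ h, mul_comm]

theorem Homotopic.walkSign_eq {c : V → V → ℤˣ} (hs : ∀ u v, G.Adj u v → c u v = c v u)
    (hc : ∀ u v w, G.Adj u v → G.Adj v w → G.Adj u w → c u v * c v w = c u w) {u v : V}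
    {p q : G.Walk u v} (h : Homotopic G p q) : walkSign c p = walkSign c q := by
  induction h with
  | refl p => rfl
  | symm _ ih => exact ih.symm
  | trans _ _ ih1 ih2 => exact ih1.trans ih2
  | cons h _ ih => simp [walkSign, ih]
  | backtrack h p =>
    simp only [walkSign]
    rw [← mul_assoc, hs _ _ h, Int.units_mul_self, one_mul]
  | triangle h1 h2 h3 p =>
    simp only [walkSign]
    rw [← mul_assoc, hc _ _ _ h1 h2 h3]

/-- The sign of a walk is a homotopy invariant, so closed walks have sign one and the sign of a walk
from a base point is a potential. -/
theorem IsSimplyConnected.signAcyclic (h : IsSimplyConnected G) : SignAcyclic G Set.univ := by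
  intro c hs hc
  have hs' : ∀ u v, G.Adj u v → c u v = c v u := fun u v => hs u trivial v trivial
  obtain ⟨hconn, hloop⟩ := h
  obtain ⟨r⟩ := hconn.nonempty
  let q : ∀ v, G.Walk r v := fun v => (hconn.preconnected r v).some
  refine ⟨fun v => walkSign c (q v), fun u _ v _ huv => ?_⟩
  have := (hloop r (((q u).append (.cons huv .nil)).append (q v).reverse)).walkSign_eq hs'
    (fun u v w => hc u trivial v trivial w trivial)
  rw [walkSign_append, walkSign_append, walkSign_reverse hs'] at this
  simp only [walkSign, mul_one] at this
  change c u v = walkSign c (q u) * walkSign c (q v)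
  revert this
  generalize walkSign c (q u) = a
  generalize walkSign c (q v) = b
  generalize c u v = d
  revert a b d
  decide

theorem signConnected_of_iso {W : Type*} {K : SimpleGraph W} (hK : K.Preconnected) {v : V}
    (φ : unitSphere G v ≃g K) : SignConnected G (G.neighborSet v) := by
  intro f hf u hu w hw
  have key : ∀ a b, K.Reachable a b → f (φ.symm a) = f (φ.symm b) := by
    rintro a b ⟨p⟩
    induction p with
    | nil => rfl
    | cons h p ih =>
      rw [← ih]
      exact hf _ (Subtype.prop _) _ (Subtype.prop _) (φ.symm.map_adj_iff.2 h)
  simpa using key (φ ⟨u, hu⟩) (φ ⟨w, hw⟩) (hK _ _)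

/-- Degrees in the unit sphere of `v` count the triangles at the edges of `v`. -/
theorem ncard_commonNeighbors_of_iso {W : Type*} {K : SimpleGraph W} {v : V}
    (φ : unitSphere G v ≃g K) (w : W) :
    (G.commonNeighbors v (φ.symm w)).ncard = (K.neighborSet w).ncard := by
  have : G.commonNeighbors v (φ.symm w) = (fun a => ((φ.symm a : G.neighborSet v) : V)) ''
      K.neighborSet w := by
    ext z
    simp only [SimpleGraph.mem_commonNeighbors, Set.mem_image, SimpleGraph.mem_neighborSet]
    constructor
    · rintro ⟨h1, h2⟩
      refine ⟨φ ⟨z, h1⟩, ?_, by simp⟩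
      rw [← φ.symm.map_adj_iff]
      simpa using h2
    · rintro ⟨a, ha, rfl⟩
      exact ⟨Subtype.prop _, φ.symm.map_adj_iff.2 ha⟩
  rw [this, Set.ncard_image_of_injective _ fun a b h => φ.symm.injective (Subtype.ext h)]

theorem ncard_neighborSet_pathGraph {n : ℕ} (i : Fin (n + 2)) :
    ((SimpleGraph.pathGraph (n + 2)).neighborSet i).ncard =
      if i = 0 ∨ i = Fin.last (n + 1) then 1 else 2 := by
  split_ifs with h
  · rw [Set.ncard_eq_one]
    rcases h with rfl | rfl
    · refine ⟨⟨1, by omega⟩, ?_⟩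
      ext j
      simp only [SimpleGraph.mem_neighborSet, SimpleGraph.pathGraph_adj, Set.mem_singleton_iff,
        Fin.ext_iff, Fin.val_zero]
      omega
    · refine ⟨⟨n, by omega⟩, ?_⟩
      ext j
      simp only [SimpleGraph.mem_neighborSet, SimpleGraph.pathGraph_adj, Set.mem_singleton_iff,
        Fin.ext_iff, Fin.val_last]
      omega
  · rw [Set.ncard_eq_two]
    simp only [Fin.ext_iff, Fin.val_zero, Fin.val_last] at h
    refine ⟨⟨i - 1, by omega⟩, ⟨i + 1, by omega⟩, by simp [Fin.ext_iff], ?_⟩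
    ext j
    simp only [SimpleGraph.mem_neighborSet, SimpleGraph.pathGraph_adj, Set.mem_insert_iff,
      Set.mem_singleton_iff, Fin.ext_iff]
    omega

theorem IsInteriorVertex.signConnected {v : V} (h : IsInteriorVertex G v) :
    SignConnected G (G.neighborSet v) := by
  obtain ⟨n, -, ⟨φ⟩⟩ := h
  exact signConnected_of_iso SimpleGraph.cycleGraph_preconnected φ

theorem IsBoundaryVertex.signConnected {v : V} (h : IsBoundaryVertex G v) :
    SignConnected G (G.neighborSet v) := by
  obtain ⟨n, -, ⟨φ⟩⟩ := h
  exact signConnected_of_iso (SimpleGraph.pathGraph_preconnected n) φ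

theorem IsInteriorVertex.ncard_commonNeighbors {v w : V} (h : IsInteriorVertex G v)
    (hvw : G.Adj v w) : (G.commonNeighbors v w).ncard = 2 := by
  obtain ⟨n, hn, ⟨φ⟩⟩ := h
  obtain ⟨n, rfl⟩ := Nat.exists_eq_add_of_le' (show 3 ≤ n by omega)
  have := ncard_commonNeighbors_of_iso φ (φ ⟨w, hvw⟩)
  rw [φ.symm_apply_apply] at this
  rw [this, ← SimpleGraph.cycleGraph_degree_three_le (v := φ ⟨w, hvw⟩),
    ← SimpleGraph.card_neighborFinset_eq_degree, ← Set.ncard_coe_finset,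
    SimpleGraph.coe_neighborFinset]

theorem IsBoundaryVertex.ncard_commonNeighbors {v w : V} (h : IsBoundaryVertex G v)
    (hvw : G.Adj v w) :
    (G.commonNeighbors v w).ncard = 1 ∨ (G.commonNeighbors v w).ncard = 2 := by
  obtain ⟨n, hn, ⟨φ⟩⟩ := h
  obtain ⟨n, rfl⟩ := Nat.exists_eq_add_of_le' hn
  have := ncard_commonNeighbors_of_iso φ (φ ⟨w, hvw⟩)
  rw [φ.symm_apply_apply] at this
  rw [this, ncard_neighborSet_pathGraph]
  split_ifs <;> simp

theorem IsBoundaryVertex.ncard_boundary_edges {v : V} (h : IsBoundaryVertex G v) :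
    {w | G.Adj v w ∧ (G.commonNeighbors v w).ncard = 1}.ncard = 2 := by
  obtain ⟨n, hn, ⟨φ⟩⟩ := h
  obtain ⟨n, rfl⟩ := Nat.exists_eq_add_of_le' hn
  have : {w | G.Adj v w ∧ (G.commonNeighbors v w).ncard = 1} =
      (fun a => ((φ.symm a : G.neighborSet v) : V)) '' {0, Fin.last (n + 1)} := by
    ext w
    simp only [Set.mem_ofPred_eq, Set.mem_image]
    constructor
    · rintro ⟨hvw, h1⟩
      refine ⟨φ ⟨w, hvw⟩, ?_, by simp⟩
      have := ncard_commonNeighbors_of_iso φ (φ ⟨w, hvw⟩)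
      rw [φ.symm_apply_apply, h1, ncard_neighborSet_pathGraph] at this
      by_contra hn
      rw [if_neg (by simpa using hn)] at this
      omega
    · rintro ⟨a, ha, rfl⟩
      refine ⟨Subtype.prop _, ?_⟩
      rw [ncard_commonNeighbors_of_iso, ncard_neighborSet_pathGraph, if_pos (by simpa using ha)]
  rw [this, Set.ncard_image_of_injective _ fun a b h => φ.symm.injective (Subtype.ext h),
    Set.ncard_pair (by simp [Fin.ext_iff])]

end Disc

theorem SignConnected.preconnected {G : SimpleGraph V} {s : Set V} (h : SignConnected G s) :
    (G.induce s).Preconnected := by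
  -- The test function is the indicator of the component of `u`.
  classical
  intro u v
  have := h (fun z => if ∃ hz : z ∈ s, (G.induce s).Reachable u ⟨z, hz⟩ then 1 else -1) (by
    intro y hy z hz hyz
    have hadj : (G.induce s).Adj ⟨y, hy⟩ ⟨z, hz⟩ := hyz
    have : (∃ hy : y ∈ s, (G.induce s).Reachable u ⟨y, hy⟩) ↔
        ∃ hz : z ∈ s, (G.induce s).Reachable u ⟨z, hz⟩ :=
      ⟨fun ⟨_, h⟩ => ⟨hz, h.trans hadj.reachable⟩, fun ⟨_, h⟩ => ⟨hy, h.trans hadj.symm.reachable⟩⟩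
    simp only [this]) u u.2 v v.2
  by_contra hn
  rw [if_pos ⟨u.2, SimpleGraph.Reachable.refl _⟩, if_neg fun ⟨_, h⟩ => hn h] at this
  exact absurd this (by decide)

/-- A finite connected 2-regular graph with a vertex removed is a path. -/
theorem exists_iso_pathGraph [Finite V] {L : SimpleGraph V} (hL : L.Preconnected)
    (h2 : ∀ v, (L.neighborSet v).ncard = 2) (x : V) :
    ∃ n, 2 ≤ n ∧ Nonempty (L.induce ({x}ᶜ : Set V) ≃g SimpleGraph.pathGraph n) := by
  have hne : ∀ v, (L.neighborSet v).Nonempty := fun v => by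
    apply Set.nonempty_of_ncard_ne_zero
    rw [h2]
    omega
  obtain ⟨p, hp, hsupp⟩ := SimpleGraph.IsCycles.exists_cycle_toSubgraph_verts_eq_connectedComponentSupp
    (c := L.connectedComponentMk x) (fun v _ => h2 v) rfl (hne x)
  have h3 := hp.three_le_length
  have hinj := hp.getVert_injOn
  have hend : p.getVert p.length = x := p.getVert_length
  have hstart : p.getVert 0 = x := p.getVert_zero
  have hx : ∀ i, 1 ≤ i → i < p.length → p.getVert i ≠ x := by
    intro i h1 hi he
    have := hinj ⟨h1, hi.le⟩ ⟨by omega, le_rfl⟩ (he.trans hend.symm)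
    omega
  -- The cycle `p` starts and ends at `x`, hence the shift by one and the loss of one vertex.
  let f : Fin (p.length - 1) → ({x}ᶜ : Set V) := fun i =>
    ⟨p.getVert (i + 1), hx _ (by omega) (by omega)⟩
  have hf : Function.Bijective f := by
    constructor
    · intro i j hij
      have := hinj ⟨by omega, by omega⟩ ⟨by omega, by omega⟩ (congrArg Subtype.val hij)
      exact Fin.ext (by omega)
    · rintro ⟨z, hz⟩
      have hzs : z ∈ p.support := by
        rw [← SimpleGraph.Walk.mem_verts_toSubgraph, hsupp]
        exact SimpleGraph.ConnectedComponent.sound (hL z x)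
      obtain ⟨k, rfl, hk⟩ := SimpleGraph.Walk.mem_support_iff_exists_getVert.1 hzs
      have k0 : k ≠ 0 := fun h => hz (by rw [h]; exact hstart)
      have k1 : k ≠ p.length := fun h => hz (by rw [h]; exact hend)
      exact ⟨⟨k - 1, by omega⟩, Subtype.ext (by simp [f, Nat.sub_add_cancel (Nat.pos_of_ne_zero k0)])⟩
  refine ⟨p.length - 1, by omega, ⟨SimpleGraph.Iso.symm ⟨Equiv.ofBijective f hf, ?_⟩⟩⟩
  intro i j
  -- By 2-regularity the two neighbours along `p` are all neighbours, so there are no chords.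
  have hnb : L.neighborSet (p.getVert (i + 1)) = {p.getVert i, p.getVert (i + 2)} := by
    symm
    apply Set.eq_of_subset_of_ncard_le
    · intro z hz
      rcases hz with rfl | rfl
      · exact (p.adj_getVert_succ (by omega)).symm
      · exact p.adj_getVert_succ (by omega)
    · have := hp.getVert_sub_one_ne_getVert_add_one (i := i + 1) (by omega)
      rw [h2, Set.ncard_pair (by simpa using this)]
    · exact Set.toFinite _
  have : (L.induce ({x}ᶜ : Set V)).Adj (f i) (f j) ↔
      p.getVert (j + 1) = p.getVert i ∨ p.getVert (j + 1) = p.getVert (i + 2) := by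
    change p.getVert (j + 1) ∈ L.neighborSet (p.getVert (i + 1)) ↔ _
    rw [hnb]
    rfl
  rw [Equiv.ofBijective_apply, Equiv.ofBijective_apply, this, SimpleGraph.pathGraph_adj]
  have hj := hx (j + 1) (by omega) (by omega)
  constructor
  · rintro (h | h)
    · have hi : (i : ℕ) ≠ 0 := fun h0 => hj (by rw [h, h0]; exact hstart)
      have := hinj ⟨by omega, by omega⟩ ⟨by omega, by omega⟩ h
      omega
    · have := hinj ⟨by omega, by omega⟩ ⟨by omega, by omega⟩ h
      omega
  · rintro (h | h)
    · right
      rw [show (j : ℕ) + 1 = i + 2 by omega]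
    · left
      rw [h]

/-! ### Punctured spheres: boundary and degrees. -/

section Ball

variable {W : Type u} {G : SimpleGraph V} {H : SimpleGraph W} {x : W}

/-- Deleting `x` removes one vertex from the unit sphere of `φ v`, a connected 2-regular graph, and
leaves a path. -/
theorem isBoundaryVertex_of_adj (hH : IsSphere 2 H) (φ : G ≃g H.induce ({x}ᶜ : Set W)) {v : V}
    (h : H.Adj x (φ v)) : IsBoundaryVertex G v := by
  have : Finite W := Set.finite_univ_iff.1 hH.finite
  let y : W := φ v
  have h2 : ∀ w, ((unitSphere H y).neighborSet w).ncard = 2 := by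
    intro w
    rw [← hH.ncard_commonNeighbors w.2]
    exact (ncard_commonNeighbors_of_iso (SimpleGraph.Iso.refl (G := unitSphere H y)) w).symm
  obtain ⟨n, hn, ⟨ψ⟩⟩ := exists_iso_pathGraph (hH.signConnected_neighborSet y).preconnected h2
    ⟨x, h.symm⟩
  refine ⟨n, hn, ⟨RelIso.trans (?_ : unitSphere G v ≃g _) ψ⟩⟩
  have hadj : ∀ a b, H.Adj (φ a) (φ b) ↔ G.Adj a b := fun a b => φ.map_adj_iff
  exact
    { toFun := fun w => ⟨⟨φ w, (hadj v w).2 w.2⟩, fun he => (φ (w : V)).2 (congrArg Subtype.val he)⟩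
      invFun := fun z => ⟨φ.symm ⟨z.1, fun he => z.2 (Subtype.ext he)⟩, by
        rw [SimpleGraph.mem_neighborSet, ← hadj, RelIso.apply_symm_apply]
        exact z.1.2⟩
      left_inv := fun w => Subtype.ext (by simp)
      right_inv := fun z => Subtype.ext (Subtype.ext (by simp))
      map_rel_iff' := fun {a b} => hadj a b }

/-- Away from `x`, edges keep both their triangles, while a boundary vertex has an edge in only one.
-/
theorem adj_of_isBoundaryVertex (hH : IsSphere 2 H) (φ : G ≃g H.induce ({x}ᶜ : Set W)) {v : V}
    (h : IsBoundaryVertex G v) : H.Adj x (φ v) := by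
  by_contra hn
  have hadj : ∀ a b, H.Adj (φ a) (φ b) ↔ G.Adj a b := fun a b => φ.map_adj_iff
  obtain ⟨w, hvw, h1⟩ : {w | G.Adj v w ∧ (G.commonNeighbors v w).ncard = 1}.Nonempty := by
    apply Set.nonempty_of_ncard_ne_zero
    rw [h.ncard_boundary_edges]
    omega
  have : H.commonNeighbors (φ v) (φ w) = (fun a => (φ a : W)) '' G.commonNeighbors v w := by
    ext z
    simp only [SimpleGraph.mem_commonNeighbors, Set.mem_image]
    constructor
    · rintro ⟨hz1, hz2⟩
      have hzx : z ≠ x := by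
        rintro rfl
        exact hn hz1.symm
      exact ⟨φ.symm ⟨z, hzx⟩, by simp [← hadj, hz1, hz2], by simp⟩
    · rintro ⟨a, ha, rfl⟩
      simpa [hadj] using ha
  have h2 := hH.ncard_commonNeighbors ((hadj v w).2 hvw)
  rw [this, Set.ncard_image_of_injective _ fun a b h => φ.injective (Subtype.ext h), h1] at h2
  omega

theorem boundaryLength_eq (hH : IsSphere 2 H) (φ : G ≃g H.induce ({x}ᶜ : Set W)) :
    boundaryLength G = (H.neighborSet x).ncard := by
  have : H.neighborSet x = (fun a => (φ a : W)) '' boundary G := by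
    ext z
    constructor
    · intro hz
      have hzx : z ≠ x := SimpleGraph.Adj.ne' hz
      refine ⟨φ.symm ⟨z, hzx⟩, isBoundaryVertex_of_adj hH φ ?_, by simp⟩
      simpa using hz
    · rintro ⟨a, ha, rfl⟩
      exact adj_of_isBoundaryVertex hH φ ha
  rw [this, Set.ncard_image_of_injective _ fun a b h => φ.injective (Subtype.ext h)]
  rfl

theorem degree_eq_of_iso [Fintype V] [Fintype W] [DecidableRel G.Adj] [DecidableRel H.Adj]
    (φ : G ≃g H.induce ({x}ᶜ : Set W)) (v : V) :
    H.degree (φ v) = G.degree v + if H.Adj x (φ v) then 1 else 0 := by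
  classical
  have hadj : ∀ a b, H.Adj (φ a) (φ b) ↔ G.Adj a b := fun a b => φ.map_adj_iff
  have hinj : Function.Injective fun a => (φ a : W) := fun a b h => φ.injective (Subtype.ext h)
  have : H.neighborFinset (φ v) = (G.neighborFinset v).image (fun a => (φ a : W)) ∪
      if H.Adj x (φ v) then {x} else ∅ := by
    ext z
    by_cases hzx : z = x
    · subst hzx
      have : ∀ a, (φ a : W) ≠ z := fun a => (φ a).2
      by_cases h : H.Adj z (φ v) <;> simp [h, H.adj_comm _ z, this]
    · have : z ∉ (if H.Adj x (φ v) then {x} else ∅ : Finset W) := by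
        split_ifs <;> simp [hzx]
      simp only [SimpleGraph.mem_neighborFinset, Finset.mem_union, this, or_false,
        Finset.mem_image]
      constructor
      · intro hz
        exact ⟨φ.symm ⟨z, hzx⟩, by simpa [← hadj] using hz, by simp⟩
      · rintro ⟨a, ha, rfl⟩
        exact (hadj v a).2 ha
  rw [← SimpleGraph.card_neighborFinset_eq_degree, this, Finset.card_union_of_disjoint,
    Finset.card_image_of_injective _ hinj, SimpleGraph.card_neighborFinset_eq_degree]
  · split_ifs <;> simp
  · have : ∀ a, (φ a : W) ≠ x := fun a => (φ a).2
    split_ifs <;> simp [this]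

theorem IsBall.no_odd_pair [Fintype V] [DecidableRel G.Adj] (hG : IsBall 2 G)
    (hlen : 3 ∣ boundaryLength G) {a b : V} (hab : G.Adj a b)
    (hodd : ∀ v, Odd (G.degree v) ↔ v = a ∨ v = b) : False := by
  classical
  obtain ⟨W, H, x, hH, ⟨φ⟩⟩ := hG
  have : Finite W := Set.finite_univ_iff.1 hH.finite
  have := Fintype.ofFinite W
  rw [boundaryLength_eq hH φ, ← SimpleGraph.coe_neighborFinset, Set.ncard_coe_finset,
    SimpleGraph.card_neighborFinset_eq_degree] at hlen
  refine punctured_no_odd_pair (a := (φ a : W)) (b := φ b) hH.signConnected_neighborSet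
    (fun u v huv => by rw [← card_commonNbrs, hH.ncard_commonNeighbors huv])
    hH.signAcyclic hlen (φ.map_adj_iff.2 hab : H.Adj (φ a) (φ b)) (φ a).2 (φ b).2 ?_
  intro z hz
  obtain ⟨v, hv⟩ := φ.surjective ⟨z, hz⟩
  obtain rfl : (φ v : W) = z := congrArg Subtype.val hv
  rw [degree_eq_of_iso φ v]
  have e : ∀ c, (φ v : W) = φ c ↔ v = c := fun c =>
    ⟨fun h => φ.injective (Subtype.ext h), fun h => by rw [h]⟩
  rw [e, e, ← hodd]
  -- A neighbour of `x` has its degree in `G` increased by two in total, so parity is unchanged.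
  split_ifs <;> simp [Nat.odd_add, add_assoc]

end Ball

theorem IsSphere.no_odd_pair [Fintype V] {G : SimpleGraph V} [DecidableRel G.Adj]
    (hG : IsSphere 2 G) {a b : V} (hab : G.Adj a b)
    (hodd : ∀ v, Odd (G.degree v) ↔ v = a ∨ v = b) : False := by
  classical
  have h2 : ∀ u v, G.Adj u v → (commonNbrs G u v).card = 2 := fun u v huv => by
    rw [← card_commonNbrs, hG.ncard_commonNeighbors huv]
  refine surface_no_odd_pair hG.signConnected_neighborSet (fun u v huv => Or.inr (h2 u v huv))
    hG.signAcyclic ?_ ?_ hab hodd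
  -- There are no boundary edges, so both boundary conditions are vacuous.
  · refine fun h _ => ⟨1, fun u v huv h1 => ?_⟩
    rw [h2 u v huv] at h1
    omega
  · refine Finset.sum_eq_zero fun u _ => Finset.sum_eq_zero fun v _ => if_neg ?_
    rintro ⟨huv, h1⟩
    rw [h2 u v huv] at h1
    omega

theorem IsDisc.no_odd_pair [Fintype V] {G : SimpleGraph V} [DecidableRel G.Adj]
    (hG : IsDisc G) (hlen : 3 ∣ boundaryLength G) {a b : V} (hab : G.Adj a b)
    (hodd : ∀ v, Odd (G.degree v) ↔ v = a ∨ v = b) : False := by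
  classical
  obtain ⟨hv, hsc, n, hn, ⟨φ⟩⟩ := hG
  have hbd : ∀ u v, G.Adj u v → (commonNbrs G u v).card = 1 → u ∈ boundary G := by
    intro u v huv h1
    refine (hv u).resolve_left fun h => ?_
    have := h.ncard_commonNeighbors huv
    rw [card_commonNbrs] at this
    omega
  refine surface_no_odd_pair ?_ ?_ hsc.signAcyclic ?_ ?_ hab hodd
  · exact fun v => (hv v).elim IsInteriorVertex.signConnected IsBoundaryVertex.signConnected
  · intro u v huv
    rw [← card_commonNbrs]
    exact (hv u).elim (fun h => Or.inr (h.ncard_commonNeighbors huv))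
      fun h => h.ncard_commonNeighbors huv
  · intro h hh
    have key : ∀ c d, (boundaryGraph G).Reachable c d → h c = h d := by
      rintro c d ⟨p⟩
      induction p with
      | nil => rfl
      | cons hcd p ih => rw [← ih, hh _ _ hcd.1 (by rw [← card_commonNbrs]; exact hcd.2)]
    have hpre : (boundaryGraph G).Preconnected :=
      φ.preconnected_iff.2 SimpleGraph.cycleGraph_preconnected
    refine ⟨h (φ.symm ⟨0, by omega⟩), fun u v huv h1 => ?_⟩
    exact key ⟨u, hbd u v huv h1⟩ _ (hpre _ _)
  -- Each boundary vertex is on two boundary edges, so the ordered count is twice the boundary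
  -- length.
  · have hrow : ∀ u, ∑ v, (if G.Adj u v ∧ (commonNbrs G u v).card = 1 then (1 : ZMod 3) else 0) =
        if u ∈ boundary G then 2 else 0 := by
      intro u
      split_ifs with hu
      · have := hu.ncard_boundary_edges
        rw [Finset.sum_boole]
        have e : {v | G.Adj u v ∧ (G.commonNeighbors u v).ncard = 1} =
            ((Finset.univ.filter fun v => G.Adj u v ∧ (commonNbrs G u v).card = 1 : Finset V) :
              Set V) := by
          ext v
          simp [card_commonNbrs]
        rw [e, Set.ncard_coe_finset] at this
        rw [this]
        rfl
      · exact Finset.sum_eq_zero fun v _ => if_neg fun h => hu (hbd u v h.1 h.2)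
    simp_rw [hrow]
    rw [← Finset.sum_filter, Finset.sum_const, nsmul_eq_mul]
    have e : (Finset.univ.filter fun u => u ∈ boundary G).card = boundaryLength G := by
      rw [boundaryLength, ← Set.ncard_coe_finset]
      congr 1
      ext
      simp
    rw [e, (ZMod.natCast_eq_zero_iff _ _).2 hlen, zero_mul]

end DiscreteSurface

theorem mainTheorem4 {V : Type*} [Fintype V] (G : SimpleGraph V) [DecidableRel G.Adj] :
    (DiscreteSurface.IsTwoBall G → ∀ k : ℕ, DiscreteSurface.boundaryLength G = 3 * k →
      ¬ ∃ a ∈ DiscreteSurface.boundary G, ∃ b ∈ DiscreteSurface.boundary G,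
        G.Adj a b ∧ ∀ v, Odd (G.degree v) ↔ v = a ∨ v = b) ∧
    (DiscreteSurface.IsSphere 2 G →
      ¬ ∃ a b : V, G.Adj a b ∧ ∀ v, Odd (G.degree v) ↔ v = a ∨ v = b) := by
  constructor
  · rintro (hG | hG) k hk ⟨a, -, b, -, hab, hodd⟩
    · exact hG.no_odd_pair ⟨k, hk⟩ hab hodd
    · exact hG.no_odd_pair ⟨k, hk⟩ hab hodd
  · rintro hG ⟨a, b, hab, hodd⟩
    exact hG.no_odd_pair hab hodd
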